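/- Setting. Let $\alpha\in[0,1]$. Alice receives two bits $x=(x_0,x_1)$, Bob a bit $y$ and Charlie a bit $z$, all independent and uniformly distributed. Alice prepares a qubit state $\rho_x$ (a density operator on $\mathbb C^2$) and sends it to Bob. Bob applies a two-outcome qubit instrument $(\mathcal B^y_0,\mathcal B^y_1)$ (completely positive maps $\mathcal B^y_b:\mathcal L(\mathbb C^2)\to\mathcal L(\mathbb C^2)$ whose sum is trace preserving), obtains the outcome $b$, and sends the post-measurement state to Charlie, who measures a qubit POVM $(C^z_0,C^z_1)$ and obtains $c$. Thus $$p(b,c\mid x,y,z)=\operatorname{tr}\bigl(\mathcal B^y_b(\rho_x)\,C^z_c\bigr),$$ and the parties may in addition average such behaviours over shared classical randomness with an arbitrary distribution. The average success probability is $$\bar P_{\rm succ}=\frac{\alpha}{8}\sum_{x,y}\Pr(b=x_y\mid x,y)+\frac{1-\alpha}{8}\sum_{x,z}\Pr(c=x_z\mid x,z).$$ Claim. The maximum of $\bar P_{\rm succ}$ over all these strategies is $$\bar P^{\rm POVM}_{\rm succ}(\alpha)=\frac12+\frac{1-\alpha}{4\sqrt2}+\frac{1}{4\sqrt2}\sqrt{(1-\alpha)^2+4\alpha^2}.$$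 For $\alpha\in(0,1)$ it is strictly larger than the bound for projective strategies $$\bar P^{\rm PVM}_{\rm succ}(\alpha)=\begin{cases}\frac12+\frac{1-\alpha}{2\sqrt2},&0\le\alpha\le1-\frac{2}{\sqrt7},\\[2pt]\frac12+\frac18\sqrt{4+(1-\alpha)^2},&1-\frac{2}{\sqrt7}<\alpha\le\frac13,\\[2pt]\frac12+\frac14\sqrt{1+\alpha^2},&\frac13<\alpha\le1.\end{cases}$$ The maximum is attained, without shared randomness, by the following strategy. Write $|\pm\rangle=(|0\rangle\pm|1\rangle)/\sqrt2$. Alice's states are $\rho_x=|\psi_x\rangle\langle\psi_x|$ with $$|\psi_{00}\rangle=\tfrac{|0\rangle+|+\rangle}{\sqrt{2+\sqrt2}},\quad|\psi_{01}\rangle=\tfrac{|0\rangle+|-\rangle}{\sqrt{2+\sqrt2}},\quad|\psi_{10}\rangle=\tfrac{|1\rangle+|+\rangle}{\sqrt{2+\sqrt2}},\quad|\psi_{11}\rangle=\tfrac{|1\rangle-|-\rangle}{\sqrt{2+\sqrt2}}.$$ Charlie measures $(|0\rangle\langle0|,|1\rangle\langle1|)$ for $z=0$ and $(|+\rangle\langle+|,|-\rangle\langle-|)$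 for $z=1$. Bob uses the Lüders instruments $\mathcal B^y_b(\rho)=K^y_b\rho K^{y\,\dagger}_b$ with $$K^y_b=\sqrt{\lambda}\,|v^y_b\rangle\langle v^y_b|+\sqrt{1-\lambda}\,|v^y_{1-b}\rangle\langle v^y_{1-b}|,\qquad\lambda=\frac12+\frac{\alpha}{\sqrt{(1-\alpha)^2+4\alpha^2}},$$ where $(v^0_0,v^0_1)=(|0\rangle,|1\rangle)$ and $(v^1_0,v^1_1)=(|+\rangle,|-\rangle)$. -/

import Mathlib

open scoped ComplexOrder MatrixOrder Matrix.Norms.L2Operator CStarAlgebra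

universe u

noncomputable section

namespace PTM

/-- Linear operators on the qubit Hilbert space `ℂ²`, as matrices in the computational basis.
The operator norm and the Loewner order make this a C⋆-algebra with its usual order. -/
abbrev Op : Type := Matrix (Fin 2) (Fin 2) ℂ

/-- Density operators of a qubit. -/
def IsState (ρ : Op) : Prop := ρ.PosSemidef ∧ ρ.trace = 1

/-- Two-outcome qubit POVMs. -/
def IsPOVM (C : Fin 2 → Op) : Prop := (∀ c, (C c).PosSemidef) ∧ C 0 + C 1 = 1

/-- Two-outcome qubit instruments: two completely positive maps whose sum preserves the trace
(so that each of them is trace nonincreasing on positive operators). -/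
def IsInstrument (B : Fin 2 → (Op →CP Op)) : Prop :=
  ∀ X : Op, (B 0 X + B 1 X).trace = X.trace

/-- A strategy in the prepare-transform-measure scenario, for a fixed value of the shared
randomness: Alice's states `ρ_x` for `x = (x₀, x₁)`, Bob's instrument for each input `y`, and
Charlie's POVM for each input `z`. -/
structure Strategy where
  state : (Fin 2 → Fin 2) → Op
  instr : Fin 2 → Fin 2 → (Op →CP Op)
  povm : Fin 2 → Fin 2 → Op
  isState : ∀ x, IsState (state x)
  isInstrument : ∀ y, IsInstrument (instr y)
  isPOVM : ∀ z, IsPOVM (povm z)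

/-- A table of numbers `p(b, c | x, y, z)`; the arguments are in the order `x y z b c`. -/
abbrev Behaviour : Type := (Fin 2 → Fin 2) → Fin 2 → Fin 2 → Fin 2 → Fin 2 → ℝ

/-- `p(b, c | x, y, z) = tr (𝓑^y_b(ρ_x) C^z_c)`. The trace is a real number. -/
def Strategy.prob (S : Strategy) : Behaviour := fun x y z b c =>
  (S.instr y b (S.state x) * S.povm z c).trace.re

/-- The behaviours `p(b, c | x, y, z)` that the parties can produce with qubit strategies and
shared classical randomness `ω`, distributed according to an arbitrary probability measure. -/
def IsRealizable (p : Behaviour) : Prop :=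
  ∃ (Ω : Type u) (_ : MeasurableSpace Ω) (μ : MeasureTheory.Measure Ω)
    (_ : MeasureTheory.IsProbabilityMeasure μ) (S : Ω → Strategy),
    (∀ x y z b c, Measurable fun ω => (S ω).prob x y z b c) ∧
    ∀ x y z b c, p x y z b c = ∫ ω, (S ω).prob x y z b c ∂μ

/-- `Pr(b | x, y)`; Charlie's input is uniformly distributed. -/
def probBob (p : Behaviour) (x : Fin 2 → Fin 2) (y b : Fin 2) : ℝ :=
  (1 / 2) * ∑ z : Fin 2, ∑ c : Fin 2, p x y z b c

/-- `Pr(c | x, z)`; Bob's input is uniformly distributed. -/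
def probCharlie (p : Behaviour) (x : Fin 2 → Fin 2) (z c : Fin 2) : ℝ :=
  (1 / 2) * ∑ y : Fin 2, ∑ b : Fin 2, p x y z b c

/-- The average success probability with weight `α` on Bob's guess. -/
def avgSuccess (α : ℝ) (p : Behaviour) : ℝ :=
  α / 8 * ∑ x : Fin 2 → Fin 2, ∑ y : Fin 2, probBob p x y (x y) +
    (1 - α) / 8 * ∑ x : Fin 2 → Fin 2, ∑ z : Fin 2, probCharlie p x z (x z)

/-- The bound for general strategies. -/
def povmBound (α : ℝ) : ℝ :=
  1 / 2 + (1 - α) / (4 * √2) + 1 / (4 * √2) * √((1 - α) ^ 2 + 4 * α ^ 2)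

/-- The bound for projective strategies and their probabilistic mixtures. -/
def pvmBound (α : ℝ) : ℝ :=
  if α ≤ 1 - 2 / √7 then 1 / 2 + (1 - α) / (2 * √2)
  else if α ≤ 1 / 3 then 1 / 2 + 1 / 8 * √(4 + (1 - α) ^ 2)
  else 1 / 2 + 1 / 4 * √(1 + α ^ 2)

/-- The orthonormal eigenbases of `Z` (`|0⟩, |1⟩`, for `z = 0`) and of `X` (`|+⟩, |-⟩`, for
`z = 1`): `basisKet z c` is the basis vector with label `c`. -/
def basisKet : Fin 2 → Fin 2 → (Fin 2 → ℂ)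
  | 0, 0 => ![1, 0]
  | 0, 1 => ![0, 1]
  | 1, 0 => ((1 / √2 : ℝ) : ℂ) • ![1, 1]
  | 1, 1 => ((1 / √2 : ℝ) : ℂ) • ![1, -1]

/-- `|ψ⟩⟨ψ|`. -/
def proj (ψ : Fin 2 → ℂ) : Op := Matrix.vecMulVec ψ (star ψ)

/-- Unnormalized state vectors of the 2 → 1 quantum random access code. -/
def qracVec : Fin 2 → Fin 2 → (Fin 2 → ℂ)
  | 0, 0 => basisKet 0 0 + basisKet 1 0
  | 0, 1 => basisKet 0 0 + basisKet 1 1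
  | 1, 0 => basisKet 0 1 + basisKet 1 0
  | 1, 1 => basisKet 0 1 - basisKet 1 1

/-- Normalized state vectors of the 2 → 1 quantum random access code. -/
def qracKet (x : Fin 2 → Fin 2) : Fin 2 → ℂ :=
  ((1 / √(2 + √2) : ℝ) : ℂ) • qracVec (x 0) (x 1)

/-- The Kraus operator (square root of the effect) of the Lüders instrument of the unsharp
measurement with effects `l |v_b⟩⟨v_b| + (1 - l) |v_{1-b}⟩⟨v_{1-b}|`, where `v` is the
`Z` basis for `y = 0` and the `X` basis for `y = 1`. -/
def ludersKraus (l : ℝ) (y b : Fin 2) : Op :=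
  ((√l : ℝ) : ℂ) • proj (basisKet y b) + ((√(1 - l) : ℝ) : ℂ) • proj (basisKet y (1 - b))

/-- The optimal sharpness. -/
def optSharpness (α : ℝ) : ℝ := 1 / 2 + α / √((1 - α) ^ 2 + 4 * α ^ 2)

end PTM

end

/-! The score is 1/2 plus 1/16 of an expression linear in the differences ρ₀₀ - ρ₁₁ and ρ₀₁ - ρ₁₀
(`Strategy.avgSuccess_eq`), so replacing these pairs by suitable antipodal pure states, with Bloch
vectors ±u and ±v, does not lower it. The bits x₀ and x₁ are then read along P = u + v and Q = u -
v, which are orthogonal with ‖P‖² + ‖Q‖² = 4.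

What Bob learns along P on input 0 destroys coherence along Q, which Charlie needs for x₁.
Positivity of the two branches confines the pair (bias along one direction, response along an
orthogonal one) to the disc of radius 2 (`bias_sq_add_response_sq_le`). Cauchy–Schwarz on this disc
bounds the contribution of each input of Bob (`bias_add_response_le`); input 1 exchanges P and Q.
Concavity of the square root then eliminates P and Q. Shared randomness only averages scores.

The Lüders strategy has u ⊥ v and lies on the boundary circle of the disc; its sharpness selects the
point of that circle parallel to (2α, 1 - α). -/

namespace PTM

open Matrix MeasureTheory

/-! ### Bloch vectors and positivity -/

/-- The traceless Hermitian operator with Bloch vector `r`. -/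
def bloch (r : EuclideanSpace ℝ (Fin 3)) : Op :=
  !![(r 2 : ℂ), r 0 - Complex.I * r 1; r 0 + Complex.I * r 1, -(r 2 : ℂ)]

/-- `bloch` as a real-linear map. -/
def blochₗ : EuclideanSpace ℝ (Fin 3) →ₗ[ℝ] Op where
  toFun := bloch
  map_add' r s := by
    ext i j
    fin_cases i <;> fin_cases j <;> simp [bloch] <;> ring
  map_smul' c r := by
    ext i j
    fin_cases i <;> fin_cases j <;> simp [bloch] <;> ring

theorem norm_sq_eq_three (r : EuclideanSpace ℝ (Fin 3)) :
    ‖r‖ ^ 2 = r 0 ^ 2 + r 1 ^ 2 + r 2 ^ 2 := by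
  rw [EuclideanSpace.norm_sq_eq, Fin.sum_univ_three]
  simp

theorem bloch_isHermitian (r : EuclideanSpace ℝ (Fin 3)) : (bloch r).IsHermitian := by
  ext i j
  fin_cases i <;> fin_cases j <;> simp [bloch, sub_eq_add_neg]

theorem bloch_mul_self (r : EuclideanSpace ℝ (Fin 3)) :
    bloch r * bloch r = ((‖r‖ ^ 2 : ℝ) : ℂ) • (1 : Op) := by
  rw [norm_sq_eq_three]
  ext i j
  fin_cases i <;> fin_cases j <;> simp [bloch, Matrix.mul_apply, Fin.sum_univ_two] <;>
    first | ring1 | linear_combination (-(r 1 : ℂ) ^ 2) * Complex.I_sq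

theorem posSemidef_smul_one_add_bloch {a : ℝ} {r : EuclideanSpace ℝ (Fin 3)} (h : ‖r‖ ≤ a) :
    (a • (1 : Op) + bloch r).PosSemidef := by
  rcases (norm_nonneg r).trans h |>.eq_or_lt with ha | ha
  · have hr : r = 0 := by
      rw [← norm_le_zero_iff, ha]; exact h
    subst hr
    rw [← ha, show bloch 0 = 0 from blochₗ.map_zero, zero_smul, zero_add]
    exact PosSemidef.zero
  -- As `bloch r` squares to ‖r‖², (a + R)² + (a² - ‖r‖²) = 2a(a + R) with R = `bloch r`.
  · have key : a • (1 : Op) + bloch r =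
        (1 / (2 * a)) • ((a • (1 : Op) + bloch r)ᴴ * (a • (1 : Op) + bloch r) +
          (a ^ 2 - ‖r‖ ^ 2) • (1 : Op)) := by
      have h1 : (a • (1 : Op) + bloch r)ᴴ = a • (1 : Op) + bloch r := by
        simp [(bloch_isHermitian r).eq]
      have h2 : bloch r * bloch r = (‖r‖ ^ 2) • (1 : Op) := by
        rw [bloch_mul_self]; rfl
      rw [h1, add_mul, mul_add, mul_add, h2]
      simp only [smul_mul_assoc, one_mul, mul_smul_comm, mul_one, smul_add, sub_smul, smul_smul]
      match_scalars <;> field_simp <;> ring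
    rw [key]
    have hsq : 0 ≤ a ^ 2 - ‖r‖ ^ 2 := by nlinarith [norm_nonneg r]
    exact ((posSemidef_conjTranspose_mul_self _).add (PosSemidef.one.smul hsq)).smul (by positivity)

theorem IsState.exists_bloch {ρ : Op} (h : IsState ρ) :
    ∃ r : EuclideanSpace ℝ (Fin 3), ‖r‖ ≤ 1 ∧ ρ = (1 / 2 : ℝ) • ((1 : Op) + bloch r) := by
  obtain ⟨hp, ht⟩ := h
  have h00 := congrArg Complex.im (hp.1.apply 0 0)
  have h11 := congrArg Complex.im (hp.1.apply 1 1)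
  have h10r := congrArg Complex.re (hp.1.apply 1 0)
  have h10i := congrArg Complex.im (hp.1.apply 1 0)
  have hd := (Complex.le_def.1 hp.det_nonneg).1
  have htr := congrArg Complex.re ht
  simp [Matrix.trace_fin_two, Matrix.det_fin_two] at h00 h11 h10r h10i hd htr
  have h00' : (ρ 0 0).im = 0 := by linarith
  have h11' : (ρ 1 1).im = 0 := by linarith
  refine ⟨!₂[2 * (ρ 0 1).re, -2 * (ρ 0 1).im, (ρ 0 0).re - (ρ 1 1).re], ?_, ?_⟩
  -- The norm bound is the inequality det ρ = (1 - ‖r‖²)/4 ≥ 0.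
  · rw [← sq_le_one_iff₀ (norm_nonneg _), norm_sq_eq_three]
    simp
    rw [h00', h11', ← h10r, ← h10i] at hd
    have e0 : (ρ 0 0).re = 1 - (ρ 1 1).re := by linarith
    rw [e0] at hd ⊢
    nlinarith
  · ext i j
    fin_cases i <;> fin_cases j <;> apply Complex.ext <;> simp [bloch] <;> linarith

/-! ### Expectation values after an instrument -/

theorem re_trace_mul_nonneg {A E : Op} (hA : A.PosSemidef) (hE : E.PosSemidef) :
    0 ≤ (A * E).trace.re := by
  obtain ⟨X, rfl⟩ := CStarAlgebra.nonneg_iff_eq_star_mul_self.1 hA.nonneg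
  rw [mul_assoc, Matrix.trace_mul_comm, mul_assoc]
  have := (hE.mul_mul_conjTranspose_same X).trace_nonneg
  rw [mul_assoc] at this
  exact (Complex.le_def.1 this).1

theorem map_posSemidef (B : Op →CP Op) {X : Op} (hX : X.PosSemidef) : (B X).PosSemidef := by
  have := map_nonneg B hX.nonneg
  exact Matrix.nonneg_iff_posSemidef.1 this

theorem CP_map_real_smul (B : Op →CP Op) (c : ℝ) (X : Op) : B (c • X) = c • B X := by
  have h (Y : Op) : c • Y = (c : ℂ) • Y := rfl
  rw [h, map_smul, h]

/-- The expectation `Pr(b = 0) - Pr(b = 1)` of the outcome of an instrument, extended linearly to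
all operators. -/
noncomputable def bias (B : Fin 2 → (Op →CP Op)) : Op →ₗ[ℝ] ℝ where
  toFun X := (B 0 X).trace.re - (B 1 X).trace.re
  map_add' X Y := by simp; ring
  map_smul' c X := by
    simp [CP_map_real_smul]; ring

/-- The expectation of the observable `C₀ - C₁` after the total channel of an instrument. -/
noncomputable def response (B : Fin 2 → (Op →CP Op)) (C : Fin 2 → Op) : Op →ₗ[ℝ] ℝ where
  toFun X := ((B 0 X + B 1 X) * (C 0 - C 1)).trace.re
  map_add' X Y := by simp [add_mul]; ring
  map_smul' c X := by
    simp [CP_map_real_smul, ← smul_add]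

/-! ### Duality between information and coherence -/

theorem sq_le_of_forall_quadratic_nonneg {p q τ : ℝ}
    (h : ∀ s t : ℝ, 0 ≤ s ^ 2 * p + t ^ 2 * q + s * t * τ) : τ ^ 2 ≤ 4 * p * q := by
  have := discrim_le_zero (a := p) (b := τ) (c := q) fun x => by
    have := h x 1
    linarith
  rw [discrim] at this
  linarith

/-- For unit vectors `e ⊥ f` this is twice the rank-one operator `|φ⟩⟨φ|` with `φ = s |e⟩ + t |-e⟩`,
where the phases of the eigenvectors `|±e⟩` of `bloch e` are adapted to `f`. -/
theorem posSemidef_coherent_combination {e f : EuclideanSpace ℝ (Fin 3)} (he : ‖e‖ ≤ 1)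
    (hf : ‖f‖ ≤ 1) (hef : inner ℝ e f = 0) (s t : ℝ) :
    ((s ^ 2) • (1 + bloch e) + (t ^ 2) • (1 - bloch e) + (2 * s * t) • bloch f).PosSemidef := by
  have h : ‖(s ^ 2 - t ^ 2) • e + (2 * s * t) • f‖ ≤ s ^ 2 + t ^ 2 := by
    rw [← sq_le_sq₀ (norm_nonneg _) (by positivity), norm_add_sq_real, norm_smul, norm_smul,
      inner_smul_left, inner_smul_right, hef, mul_pow, mul_pow, Real.norm_eq_abs, Real.norm_eq_abs,
      sq_abs, sq_abs]
    have h1 : ‖e‖ ^ 2 ≤ 1 := pow_le_one₀ (norm_nonneg _) he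
    have h2 : ‖f‖ ^ 2 ≤ 1 := pow_le_one₀ (norm_nonneg _) hf
    nlinarith [mul_le_mul_of_nonneg_left h1 (sq_nonneg (s ^ 2 - t ^ 2)),
      mul_le_mul_of_nonneg_left h2 (sq_nonneg (2 * s * t))]
  have := posSemidef_smul_one_add_bloch h
  convert this using 1
  rw [show bloch ((s ^ 2 - t ^ 2) • e + (2 * s * t) • f) =
    (s ^ 2 - t ^ 2) • bloch e + (2 * s * t) • bloch f from by
      change blochₗ _ = _ • blochₗ _ + _ • blochₗ _
      rw [map_add, map_smul, map_smul]]
  match_scalars <;> ring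

/-- The coherence that survives one branch is at most the geometric mean of its populations. -/
theorem sq_re_trace_mul_le (B : Op →CP Op) {C : Fin 2 → Op} (hC : IsPOVM C)
    {e f : EuclideanSpace ℝ (Fin 3)} (he : ‖e‖ ≤ 1) (hf : ‖f‖ ≤ 1) (hef : inner ℝ e f = 0) :
    (B (bloch f) * (C 0 - C 1)).trace.re ^ 2 ≤
      (B (1 + bloch e)).trace.re * (B (1 - bloch e)).trace.re := by
  have key := sq_le_of_forall_quadratic_nonneg (p := (B (1 + bloch e)).trace.re)
    (q := (B (1 - bloch e)).trace.re) (τ := 2 * (B (bloch f) * (C 0 - C 1)).trace.re) ?_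
  · linarith
  intro s t
  -- Opposite relative signs for the two outcomes of Charlie: in the sum the populations combine
  -- through C₀ + C₁ = 1 and the coherence through C₀ - C₁.
  have h0 := re_trace_mul_nonneg
    (map_posSemidef B (posSemidef_coherent_combination he hf hef s t)) (hC.1 0)
  have h1 := re_trace_mul_nonneg
    (map_posSemidef B (posSemidef_coherent_combination he hf hef s (-t))) (hC.1 1)
  have e1 (X : Op) : X.trace = (X * C 0).trace + (X * C 1).trace := by
    rw [← Matrix.trace_add, ← mul_add, hC.2, mul_one]
  rw [e1 (B (1 + bloch e)), e1 (B (1 - bloch e))]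
  rw [map_add, map_add, CP_map_real_smul, CP_map_real_smul, CP_map_real_smul] at h0 h1
  simp only [add_mul, smul_mul_assoc, Matrix.trace_add, Matrix.trace_smul, Complex.add_re,
    Complex.real_smul, Complex.re_ofReal_mul, mul_sub, Matrix.trace_sub, Complex.sub_re] at h0 h1 ⊢
  linarith

/-- Duality between which-way information and coherence. -/
theorem bias_sq_add_response_sq_le {B : Fin 2 → (Op →CP Op)} (hB : IsInstrument B)
    {C : Fin 2 → Op} (hC : IsPOVM C) {e f : EuclideanSpace ℝ (Fin 3)} (he : ‖e‖ ≤ 1)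
    (hf : ‖f‖ ≤ 1) (hef : inner ℝ e f = 0) :
    bias B (bloch e) ^ 2 + response B C (bloch f) ^ 2 ≤ 4 := by
  have h0 := sq_re_trace_mul_le (B 0) hC he hf hef
  have h1 := sq_re_trace_mul_le (B 1) hC he hf hef
  have psd (b : Fin 2) : 0 ≤ (B b (1 + bloch e)).trace.re ∧ 0 ≤ (B b (1 - bloch e)).trace.re := by
    have p := map_posSemidef (B b) (posSemidef_coherent_combination he hf hef 1 0)
    have q := map_posSemidef (B b) (posSemidef_coherent_combination he hf hef 0 1)
    simp only [one_pow, one_smul, ne_eq, OfNat.ofNat_ne_zero, not_false_eq_true, zero_pow,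
      zero_smul, add_zero, mul_zero, mul_one, zero_add] at p q
    exact ⟨(Complex.le_def.1 p.trace_nonneg).1, (Complex.le_def.1 q.trace_nonneg).1⟩
  have tb : (bloch e).trace = 0 := by simp [bloch, Matrix.trace_fin_two]
  have t0 := congrArg Complex.re (hB (1 + bloch e))
  have t1 := congrArg Complex.re (hB (1 - bloch e))
  have hb : 2 * bias B (bloch e) = ((B 0 (1 + bloch e)).trace.re - (B 0 (1 - bloch e)).trace.re) -
      ((B 1 (1 + bloch e)).trace.re - (B 1 (1 - bloch e)).trace.re) := by
    simp [bias]; ring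
  have hr : response B C (bloch f) = (B 0 (bloch f) * (C 0 - C 1)).trace.re +
      (B 1 (bloch f) * (C 0 - C 1)).trace.re := by
    simp [response, add_mul]
  simp only [Matrix.trace_add, Matrix.trace_sub, tb, Matrix.trace_one, Complex.add_re] at t0 t1
  simp [-map_add, -map_sub] at t0 t1
  obtain ⟨p0, q0⟩ := psd 0
  obtain ⟨p1, q1⟩ := psd 1
  rw [hr]
  generalize (B 0 (bloch f) * (C 0 - C 1)).trace.re = τ₀ at *
  generalize (B 1 (bloch f) * (C 0 - C 1)).trace.re = τ₁ at *
  generalize (B 0 (1 + bloch e)).trace.re = a₀ at *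
  generalize (B 1 (1 + bloch e)).trace.re = a₁ at *
  generalize (B 0 (1 - bloch e)).trace.re = b₀ at *
  generalize (B 1 (1 - bloch e)).trace.re = b₁ at *
  generalize bias B (bloch e) = m at *
  obtain rfl : a₁ = 2 - a₀ := by linarith
  obtain rfl : b₁ = 2 - b₀ := by linarith
  obtain rfl : m = a₀ - b₀ := by linarith
  -- The branch bounds give |τ₀τ₁| ≤ √(a₀a₁ · b₀b₁), and the arithmetic–geometric mean inequality is
  -- applied to a₀a₁ and b₀b₁. With this pairing all terms in a₀ and b₀ cancel in the final sum,
  -- leaving 4.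
  have hx : |2 * (τ₀ * τ₁)| ≤ a₀ * (2 - a₀) + b₀ * (2 - b₀) := by
    apply abs_le_of_sq_le_sq
    · have := mul_le_mul h0 h1 (sq_nonneg _) (by positivity)
      nlinarith [sq_nonneg (a₀ * (2 - a₀) - b₀ * (2 - b₀))]
    · positivity
  nlinarith [(abs_le.1 hx).2]

/-! ### The score as a linear function of the states -/

/-- The functional through which the states prepared by Alice contribute to guesses of the bit
with index `i`. -/
noncomputable def scoreFunctional (α : ℝ) (S : Strategy) (i : Fin 2) : Op →ₗ[ℝ] ℝ :=
  α • bias (S.instr i) +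
    ((1 - α) / 2) • (response (S.instr 0) (S.povm i) + response (S.instr 1) (S.povm i))

theorem Strategy.sum_prob (S : Strategy) (x : Fin 2 → Fin 2) (y z b : Fin 2) :
    S.prob x y z b 0 + S.prob x y z b 1 = (S.instr y b (S.state x)).trace.re := by
  simp only [Strategy.prob]
  rw [← Complex.add_re, ← Matrix.trace_add, ← mul_add, (S.isPOVM z).2, mul_one]

theorem Strategy.sum_trace_instr (S : Strategy) (x : Fin 2 → Fin 2) (y : Fin 2) :
    (S.instr y 0 (S.state x)).trace.re + (S.instr y 1 (S.state x)).trace.re = 1 := by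
  rw [← Complex.add_re, ← Matrix.trace_add, S.isInstrument y, (S.isState x).2, Complex.one_re]

theorem Strategy.probBob_eq (S : Strategy) (x : Fin 2 → Fin 2) (y b : Fin 2) :
    probBob S.prob x y b = (1 + (-1) ^ (b : ℕ) * bias (S.instr y) (S.state x)) / 2 := by
  have h := S.sum_trace_instr x y
  simp only [probBob, Fin.sum_univ_two, S.sum_prob]
  have hb : bias (S.instr y) (S.state x) =
    (S.instr y 0 (S.state x)).trace.re - (S.instr y 1 (S.state x)).trace.re := rfl
  rw [hb]
  fin_cases b <;> simp <;> linarith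

theorem Strategy.probCharlie_eq (S : Strategy) (x : Fin 2 → Fin 2) (z c : Fin 2) :
    probCharlie S.prob x z c = (1 + (-1) ^ (c : ℕ) * ((1 / 2) *
      (response (S.instr 0) (S.povm z) (S.state x) +
        response (S.instr 1) (S.povm z) (S.state x)))) / 2 := by
  have hr (y : Fin 2) : response (S.instr y) (S.povm z) (S.state x) =
      S.prob x y z 0 0 + S.prob x y z 1 0 - S.prob x y z 0 1 - S.prob x y z 1 1 := by
    simp [response, Strategy.prob, add_mul, mul_sub]; ring
  have h0 := S.sum_trace_instr x 0
  have h1 := S.sum_trace_instr x 1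
  rw [← S.sum_prob x 0 z, ← S.sum_prob x 0 z] at h0
  rw [← S.sum_prob x 1 z, ← S.sum_prob x 1 z] at h1
  simp only [probCharlie, Fin.sum_univ_two, hr]
  fin_cases c <;> simp <;> linarith

theorem sum_fin_two_arrow (F : (Fin 2 → Fin 2) → ℝ) :
    ∑ x, F x = F ![0, 0] + F ![0, 1] + F ![1, 0] + F ![1, 1] := by
  rw [← (finTwoArrowEquiv (Fin 2)).symm.sum_comp, Fintype.sum_prod_type]
  simp [Fin.sum_univ_two, finTwoArrowEquiv]
  ring

/-- The bit with index i enters with the sign (-1)^(x i), so complementing x reverses every sign and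
only differences of complementary states remain. -/
theorem Strategy.avgSuccess_eq (α : ℝ) (S : Strategy) :
    avgSuccess α S.prob = 1 / 2 + 1 / 16 *
      (scoreFunctional α S 0 (S.state ![0, 0] - S.state ![1, 1]) +
       scoreFunctional α S 1 (S.state ![0, 0] - S.state ![1, 1]) +
       scoreFunctional α S 0 (S.state ![0, 1] - S.state ![1, 0]) -
       scoreFunctional α S 1 (S.state ![0, 1] - S.state ![1, 0])) := by
  simp only [avgSuccess, sum_fin_two_arrow, Fin.sum_univ_two, S.probBob_eq, S.probCharlie_eq,
    map_sub, scoreFunctional, LinearMap.add_apply, LinearMap.smul_apply, smul_eq_mul]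
  simp
  ring

/-! ### Upper bound for a single strategy -/

/-- A real-linear functional on differences of states is maximized by antipodal pure states. -/
theorem exists_unit_forall_state_sub_le (φ : Op →ₗ[ℝ] ℝ) :
    ∃ u : EuclideanSpace ℝ (Fin 3), ‖u‖ = 1 ∧
      ∀ ρ ρ', IsState ρ → IsState ρ' → φ (ρ - ρ') ≤ φ (bloch u) := by
  let ψ : EuclideanSpace ℝ (Fin 3) →L[ℝ] ℝ := LinearMap.toContinuousLinearMap (φ ∘ₗ blochₗ)
  let w := (InnerProductSpace.toDual ℝ (EuclideanSpace ℝ (Fin 3))).symm ψ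
  have hw (r) : φ (bloch r) = inner ℝ w r := by
    rw [InnerProductSpace.toDual_symm_apply]; rfl
  obtain ⟨u, hu, hwu⟩ : ∃ u : EuclideanSpace ℝ (Fin 3), ‖u‖ = 1 ∧ ‖w‖ ≤ inner ℝ w u := by
    by_cases h : w = 0
    · exact ⟨EuclideanSpace.single 0 1, by simp, by simp [h]⟩
    · refine ⟨‖w‖⁻¹ • w, ?_, ?_⟩
      · rw [norm_smul, norm_inv, norm_norm, inv_mul_cancel₀ (norm_ne_zero_iff.2 h)]
      · rw [inner_smul_right, real_inner_self_eq_norm_sq]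
        have := norm_ne_zero_iff.2 h
        exact le_of_eq (by field_simp)
  refine ⟨u, hu, fun ρ ρ' hρ hρ' => ?_⟩
  obtain ⟨r, hr, rfl⟩ := hρ.exists_bloch
  obtain ⟨r', hr', rfl⟩ := hρ'.exists_bloch
  have e : (1 / 2 : ℝ) • ((1 : Op) + bloch r) - (1 / 2 : ℝ) • ((1 : Op) + bloch r') =
      bloch ((1 / 2 : ℝ) • (r - r')) := by
    change _ • (_ + blochₗ r) - _ • (_ + blochₗ r') = blochₗ _
    rw [map_smul, map_sub]
    module
  rw [e, hw, hw]
  refine ((real_inner_le_norm _ _).trans ?_).trans hwu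
  have : ‖(1 / 2 : ℝ) • (r - r')‖ ≤ 1 := by
    rw [norm_smul]
    have := norm_sub_le r r'
    norm_num
    linarith
  nlinarith [norm_nonneg w]

/-- The trade-off between Bob's guess along `P` and Charlie's guesses along `P` and `Q`. -/
theorem bias_add_response_le {α : ℝ} (hα : α ∈ Set.Icc (0 : ℝ) 1) {B : Fin 2 → (Op →CP Op)}
    (hB : IsInstrument B) {C D : Fin 2 → Op} (hC : IsPOVM C) (hD : IsPOVM D)
    {P Q : EuclideanSpace ℝ (Fin 3)} (hPQ : inner ℝ P Q = 0) :
    α * bias B (bloch P) + (1 - α) / 2 * (response B C (bloch P) + response B D (bloch Q)) ≤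
      (1 - α) * ‖P‖ + √((1 - α) ^ 2 * ‖Q‖ ^ 2 + 4 * α ^ 2 * ‖P‖ ^ 2) := by
  -- Since 0⁻¹ = 0, the zero vector normalizes to itself; the duality assumes only norm at most 1
  -- and so covers it.
  have normalize (R : EuclideanSpace ℝ (Fin 3)) :
      ‖‖R‖⁻¹ • R‖ ≤ 1 ∧ bloch R = ‖R‖ • bloch (‖R‖⁻¹ • R) := by
    constructor
    · rw [norm_smul, norm_inv, norm_norm]
      exact inv_mul_le_one
    · change blochₗ R = _ • blochₗ _
      rw [map_smul, smul_smul]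
      by_cases h : R = 0
      · simp [h]
      · rw [mul_inv_cancel₀ (norm_ne_zero_iff.2 h), one_smul]
  obtain ⟨hP, eP⟩ := normalize P
  obtain ⟨hQ, eQ⟩ := normalize Q
  have hef : inner ℝ (‖P‖⁻¹ • P) (‖Q‖⁻¹ • Q) = (0 : ℝ) := by
    rw [inner_smul_left, inner_smul_right, hPQ]; simp
  have h1 := bias_sq_add_response_sq_le hB hD hP hQ hef
  have h2 := bias_sq_add_response_sq_le hB hC hQ hP (by rw [real_inner_comm]; exact hef)
  rw [eP, eQ]
  simp only [map_smul, smul_eq_mul]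
  generalize bias B (bloch (‖P‖⁻¹ • P)) = m at *
  generalize response B C (bloch (‖P‖⁻¹ • P)) = c at *
  generalize response B D (bloch (‖Q‖⁻¹ • Q)) = d at *
  have hc : c ≤ 2 := by nlinarith [sq_nonneg (bias B (bloch (‖Q‖⁻¹ • Q)))]
  have hP0 := norm_nonneg P
  generalize ‖P‖ = p at *
  generalize ‖Q‖ = q at *
  have h3 : α * (p * m) + (1 - α) / 2 * (q * d) ≤
      √((1 - α) ^ 2 * q ^ 2 + 4 * α ^ 2 * p ^ 2) := by
    apply Real.le_sqrt_of_sq_le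
    have hn : 0 ≤ (α * p) ^ 2 + ((1 - α) / 2 * q) ^ 2 := by positivity
    -- Cauchy–Schwarz via Lagrange's identity, with m² + d² ≤ 4.
    nlinarith [sq_nonneg (α * p * d - (1 - α) / 2 * q * m), mul_le_mul_of_nonneg_left h1 hn]
  have h4 : (1 - α) / 2 * (p * c) ≤ (1 - α) * p := by
    have : 0 ≤ (1 - α) / 2 * p * (2 - c) :=
      mul_nonneg (mul_nonneg (by linarith [hα.2]) hP0) (by linarith)
    linarith
  linarith

/-- Concavity of the square root. It serves for ‖P‖ + ‖Q‖ and for the two trade-off radicals, whose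
radicands have a sum independent of the angle between u and v. -/
theorem sqrt_add_sqrt_le {a b c : ℝ} (ha : 0 ≤ a) (hb : 0 ≤ b) (h : a + b = 4 * c) :
    √a + √b ≤ 2 * √2 * √c := by
  have hc : 0 ≤ c := by linarith
  apply le_of_sq_le_sq _ (by positivity)
  nlinarith [Real.sq_sqrt ha, Real.sq_sqrt hb, Real.sq_sqrt hc,
    Real.sq_sqrt (show (0 : ℝ) ≤ 2 by norm_num), sq_nonneg (√a - √b)]

theorem povmBound_eq (α : ℝ) :
    povmBound α = 1 / 2 + √2 / 8 * ((1 - α) + √((1 - α) ^ 2 + 4 * α ^ 2)) := by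
  have h : (1 : ℝ) / (4 * √2) = √2 / 8 := by
    field_simp
    norm_num
  rw [povmBound, ← h]
  ring

theorem Strategy.avgSuccess_le {α : ℝ} (hα : α ∈ Set.Icc (0 : ℝ) 1) (S : Strategy) :
    avgSuccess α S.prob ≤ povmBound α := by
  rw [S.avgSuccess_eq]
  obtain ⟨u, hu, hu'⟩ :=
    exists_unit_forall_state_sub_le (scoreFunctional α S 0 + scoreFunctional α S 1)
  obtain ⟨v, hv, hv'⟩ :=
    exists_unit_forall_state_sub_le (scoreFunctional α S 0 - scoreFunctional α S 1)
  have h1 := hu' _ _ (S.isState ![0, 0]) (S.isState ![1, 1])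
  have h2 := hv' _ _ (S.isState ![0, 1]) (S.isState ![1, 0])
  have horth : inner ℝ (u + v) (u - v) = (0 : ℝ) := by
    rw [inner_add_left, inner_sub_right, inner_sub_right, real_inner_self_eq_norm_sq,
      real_inner_self_eq_norm_sq, real_inner_comm u v, hu, hv]
    ring
  have hpar : ‖u + v‖ ^ 2 + ‖u - v‖ ^ 2 = 4 := by
    have := parallelogram_law_with_norm ℝ u v
    rw [hu, hv] at this
    nlinarith
  -- φ₀(P) + φ₁(Q) is regrouped by the input of Bob, φᵢ being `scoreFunctional α S i`.
  have k0 := bias_add_response_le hα (S.isInstrument 0) (S.isPOVM 0) (S.isPOVM 1) horth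
  have k1 := bias_add_response_le hα (S.isInstrument 1) (S.isPOVM 1) (S.isPOVM 0)
    (by rw [real_inner_comm]; exact horth)
  have eP : bloch (u + v) = bloch u + bloch v := blochₗ.map_add u v
  have eQ : bloch (u - v) = bloch u - bloch v := blochₗ.map_sub u v
  have l1 : ‖u + v‖ + ‖u - v‖ ≤ 2 * √2 := by
    have := sqrt_add_sqrt_le (sq_nonneg ‖u + v‖) (sq_nonneg ‖u - v‖) (c := 1) (by linarith)
    simpa using this
  have l2 := sqrt_add_sqrt_le (a := (1 - α) ^ 2 * ‖u - v‖ ^ 2 + 4 * α ^ 2 * ‖u + v‖ ^ 2)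
    (b := (1 - α) ^ 2 * ‖u + v‖ ^ 2 + 4 * α ^ 2 * ‖u - v‖ ^ 2)
    (c := (1 - α) ^ 2 + 4 * α ^ 2) (by positivity) (by positivity)
    (by linear_combination ((1 - α) ^ 2 + 4 * α ^ 2) * hpar)
  have l3 := mul_le_mul_of_nonneg_left l1 (sub_nonneg.2 hα.2)
  rw [eP, eQ] at k0 k1
  simp only [scoreFunctional, LinearMap.add_apply, LinearMap.sub_apply, LinearMap.smul_apply,
    smul_eq_mul] at h1 h2 ⊢
  simp only [map_add, map_sub] at h1 h2 k0 k1 ⊢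
  rw [povmBound_eq]
  linarith

/-! ### Shared randomness -/

theorem Strategy.prob_nonneg (S : Strategy) (x : Fin 2 → Fin 2) (y z b c : Fin 2) :
    0 ≤ S.prob x y z b c :=
  re_trace_mul_nonneg (map_posSemidef _ (S.isState x).1) ((S.isPOVM z).1 c)

theorem Strategy.prob_le_one (S : Strategy) (x : Fin 2 → Fin 2) (y z b c : Fin 2) :
    S.prob x y z b c ≤ 1 := by
  have h := S.sum_trace_instr x y
  rw [← S.sum_prob x y z, ← S.sum_prob x y z] at h
  have h00 := S.prob_nonneg x y z 0 0
  have h01 := S.prob_nonneg x y z 0 1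
  have h10 := S.prob_nonneg x y z 1 0
  have h11 := S.prob_nonneg x y z 1 1
  fin_cases b <;> fin_cases c <;> simp <;> linarith

theorem avgSuccess_eq_integral (α : ℝ) {Ω : Type u} [MeasurableSpace Ω] {μ : Measure Ω}
    {q : Ω → Behaviour} (hq : ∀ x y z b c, Integrable (fun ω => q ω x y z b c) μ)
    {p : Behaviour} (hp : ∀ x y z b c, p x y z b c = ∫ ω, q ω x y z b c ∂μ) :
    Integrable (fun ω => avgSuccess α (q ω)) μ ∧
      avgSuccess α p = ∫ ω, avgSuccess α (q ω) ∂μ := by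
  have hB (x : Fin 2 → Fin 2) (y b : Fin 2) : Integrable (fun ω => probBob (q ω) x y b) μ ∧
      probBob p x y b = ∫ ω, probBob (q ω) x y b ∂μ := by
    have h1 (z : Fin 2) : Integrable (fun ω => ∑ c, q ω x y z b c) μ :=
      integrable_finsetSum _ fun c _ => hq x y z b c
    refine ⟨(integrable_finsetSum _ fun z _ => h1 z).const_mul _, ?_⟩
    simp only [probBob]
    rw [integral_const_mul, integral_finsetSum _ fun z _ => h1 z]
    simp_rw [integral_finsetSum _ fun c _ => hq x y _ b c, hp]
  have hC (x : Fin 2 → Fin 2) (z c : Fin 2) : Integrable (fun ω => probCharlie (q ω) x z c) μ ∧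
      probCharlie p x z c = ∫ ω, probCharlie (q ω) x z c ∂μ := by
    have h1 (y : Fin 2) : Integrable (fun ω => ∑ b, q ω x y z b c) μ :=
      integrable_finsetSum _ fun b _ => hq x y z b c
    refine ⟨(integrable_finsetSum _ fun y _ => h1 y).const_mul _, ?_⟩
    simp only [probCharlie]
    rw [integral_const_mul, integral_finsetSum _ fun y _ => h1 y]
    simp_rw [integral_finsetSum _ fun b _ => hq x _ z b c, hp]
  have hB' (x : Fin 2 → Fin 2) : Integrable (fun ω => ∑ y, probBob (q ω) x y (x y)) μ :=
    integrable_finsetSum _ fun y _ => (hB x y (x y)).1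
  have hC' (x : Fin 2 → Fin 2) : Integrable (fun ω => ∑ z, probCharlie (q ω) x z (x z)) μ :=
    integrable_finsetSum _ fun z _ => (hC x z (x z)).1
  have iB : Integrable (fun ω => ∑ x, ∑ y, probBob (q ω) x y (x y)) μ :=
    integrable_finsetSum _ fun x _ => hB' x
  have iC : Integrable (fun ω => ∑ x, ∑ z, probCharlie (q ω) x z (x z)) μ :=
    integrable_finsetSum _ fun x _ => hC' x
  refine ⟨(iB.const_mul _).add (iC.const_mul _), ?_⟩
  simp only [avgSuccess]
  rw [integral_add (iB.const_mul _) (iC.const_mul _), integral_const_mul, integral_const_mul,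
    integral_finsetSum _ fun x _ => hB' x, integral_finsetSum _ fun x _ => hC' x]
  simp_rw [integral_finsetSum _ fun y _ => (hB _ y _).1,
    integral_finsetSum _ fun z _ => (hC _ z _).1, (hB _ _ _).2, (hC _ _ _).2]

theorem avgSuccess_le_of_isRealizable {α : ℝ} (hα : α ∈ Set.Icc (0 : ℝ) 1) {p : Behaviour}
    (hp : IsRealizable.{u} p) : avgSuccess α p ≤ povmBound α := by
  obtain ⟨Ω, _, μ, _, S, hm, hp⟩ := hp
  obtain ⟨hi, he⟩ := avgSuccess_eq_integral α (q := fun ω => (S ω).prob) (fun x y z b c =>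
    Integrable.of_bound (hm x y z b c).aestronglyMeasurable 1
      (Filter.Eventually.of_forall fun ω => by
      rw [Real.norm_eq_abs, abs_of_nonneg ((S ω).prob_nonneg x y z b c)]
      exact (S ω).prob_le_one x y z b c)) hp
  rw [he]
  refine (integral_mono hi (integrable_const _) fun ω => (S ω).avgSuccess_le hα).trans ?_
  simp

theorem Strategy.isRealizable_prob (S : Strategy) : IsRealizable.{u} S.prob :=
  ⟨PUnit, inferInstance, Measure.dirac PUnit.unit, inferInstance, fun _ => S,
    fun _ _ _ _ _ => measurable_const, fun _ _ _ _ _ => by simp⟩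

/-! ### Comparison with projective strategies -/

theorem pvmBound_lt_povmBound {α : ℝ} (hα : α ∈ Set.Ioo (0 : ℝ) 1) :
    pvmBound α < povmBound α := by
  obtain ⟨h0, h1⟩ := hα
  have hs' : (1 - α) / (2 * √2) = √2 / 8 * (2 * (1 - α)) := by
    field_simp
    norm_num
  have h2 : √2 ^ 2 = 2 := Real.sq_sqrt (by norm_num)
  have h2' : 0 < √2 := by positivity
  have hS : √((1 - α) ^ 2 + 4 * α ^ 2) ^ 2 = (1 - α) ^ 2 + 4 * α ^ 2 :=
    Real.sq_sqrt (by positivity)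
  have hS0 : 0 ≤ √((1 - α) ^ 2 + 4 * α ^ 2) := Real.sqrt_nonneg _
  rw [povmBound_eq, pvmBound]
  generalize √((1 - α) ^ 2 + 4 * α ^ 2) = s at *
  have hT (x : ℝ) (hx : x < 2 * (1 - α + s) ^ 2) : √x < √2 * (1 - α + s) := by
    rw [Real.sqrt_lt' (by nlinarith), mul_pow, h2]
    exact hx
  split_ifs with hc hd
  · rw [hs']
    have : 1 - α < s := by nlinarith
    nlinarith
  -- 6/25 lies just below 1 - 2/√7 ≈ 0.244, because √7 > 50/19.
  · have hα' : 6 / 25 < α := by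
      have h7 : √7 ^ 2 = 7 := Real.sq_sqrt (by norm_num)
      have h7' : 0 < √7 := by positivity
      have h7'' : √7 < 50 / 19 + 1 / 50 := by nlinarith
      have : 2 / √7 < 19 / 25 := by
        rw [div_lt_iff₀ h7']
        nlinarith [Real.lt_sqrt (x := 50 / 19) (y := 7) (by norm_num) |>.2 (by norm_num)]
      push Not at hc
      linarith
    -- 2s² - (1 + α)² = (1 - 3α)², and 7/10 is slightly less than 1/√2.
    have hs1 : 7 / 10 * (1 + α) < s := by nlinarith [sq_nonneg (1 - 3 * α)]
    have := hT (4 + (1 - α) ^ 2) (by nlinarith)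
    nlinarith
  -- The gap between the squares is 2(1 - α + s)² - 4(1 + α²) = 4(1 - α)(s - 2α).
  · have : 2 * α < s := by nlinarith
    have h4 : √(4 * (1 + α ^ 2)) = 2 * √(1 + α ^ 2) := by
      rw [Real.sqrt_mul (by norm_num), show (4 : ℝ) = 2 ^ 2 by norm_num,
        Real.sqrt_sq (by norm_num)]
    have := hT (4 * (1 + α ^ 2)) (by nlinarith)
    nlinarith

/-! ### The optimal strategy -/

theorem exists_eq_star_mul_self {R : Type*} [NonUnitalCStarAlgebra R] [PartialOrder R]
    [StarOrderedRing R] {M : R} (hM : 0 ≤ M) : ∃ a, M = star a * a :=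
  CStarAlgebra.nonneg_iff_eq_star_mul_self.1 hM

/-- The completely positive map with a single Kraus operator. -/
noncomputable def krausMap (K : Op) : Op →CP Op where
  toFun X := K * X * Kᴴ
  map_add' X Y := by rw [mul_add, add_mul]
  map_smul' c X := by simp
  map_cstarMatrix_nonneg' k M hM := by
    obtain ⟨a, rfl⟩ := exists_eq_star_mul_self hM
    -- Conjugating every entry of a⋆a by K gives b⋆b, where b has the entries of a multiplied on the
    -- right by Kᴴ.
    convert star_mul_self_nonneg (a.map (· * Kᴴ)) using 1
    ext1 i j
    simp only [CStarMatrix.map_apply, CStarMatrix.mul_apply, CStarMatrix.star_apply,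
      LinearMap.coe_mk, AddHom.coe_mk, Finset.mul_sum, Finset.sum_mul, star_mul,
      Matrix.star_eq_conjTranspose, conjTranspose_conjTranspose, mul_assoc]

theorem krausMap_apply (K X : Op) : krausMap K X = K * X * Kᴴ := rfl

theorem proj_posSemidef (ψ : Fin 2 → ℂ) : (proj ψ).PosSemidef :=
  posSemidef_vecMulVec_self_star ψ

theorem proj_apply (ψ : Fin 2 → ℂ) (i j : Fin 2) : proj ψ i j = ψ i * star (ψ j) := rfl

theorem ofReal_inv_sqrt_two_mul_self :
    ((√2 : ℝ) : ℂ)⁻¹ * ((√2 : ℝ) : ℂ)⁻¹ = 1 / 2 := by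
  rw [← mul_inv, ← Complex.ofReal_mul, Real.mul_self_sqrt (by norm_num)]
  norm_num

theorem proj_basisKet_zero_zero : proj (basisKet 0 0) = !![1, 0; 0, 0] := by
  ext i j
  fin_cases i <;> fin_cases j <;> simp [proj, basisKet, vecMulVec_apply]

theorem proj_basisKet_zero_one : proj (basisKet 0 1) = !![0, 0; 0, 1] := by
  ext i j
  fin_cases i <;> fin_cases j <;> simp [proj, basisKet, vecMulVec_apply]

theorem proj_basisKet_one_zero :
    proj (basisKet 1 0) = !![1 / 2, 1 / 2; 1 / 2, 1 / 2] := by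
  ext i j
  fin_cases i <;> fin_cases j <;>
    simp [proj, basisKet, vecMulVec_apply, ofReal_inv_sqrt_two_mul_self]

theorem proj_basisKet_one_one :
    proj (basisKet 1 1) = !![1 / 2, -(1 / 2); -(1 / 2), 1 / 2] := by
  ext i j
  fin_cases i <;> fin_cases j <;>
    simp [proj, basisKet, vecMulVec_apply, ofReal_inv_sqrt_two_mul_self]

theorem isPOVM_proj_basisKet (z : Fin 2) : IsPOVM fun c => proj (basisKet z c) := by
  refine ⟨fun c => proj_posSemidef _, ?_⟩
  fin_cases z
  · simp only [Fin.zero_eta, proj_basisKet_zero_zero, proj_basisKet_zero_one]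
    ext i j
    fin_cases i <;> fin_cases j <;> simp
  · simp only [Fin.mk_one, proj_basisKet_one_zero, proj_basisKet_one_one]
    ext i j
    fin_cases i <;> fin_cases j <;> simp <;> norm_num

theorem proj_basisKet_mul_proj_basisKet (y b c : Fin 2) :
    proj (basisKet y b) * proj (basisKet y c) = if b = c then proj (basisKet y b) else 0 := by
  fin_cases y <;> fin_cases b <;> fin_cases c <;>
    simp [proj_basisKet_zero_zero, proj_basisKet_zero_one, proj_basisKet_one_zero,
      proj_basisKet_one_one, ← Matrix.ext_iff, Fin.forall_fin_two] <;> norm_num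
  all_goals
    ext i
    fin_cases i <;> simp

theorem ludersKraus_isHermitian (l : ℝ) (y b : Fin 2) : (ludersKraus l y b).IsHermitian := by
  simp [IsHermitian, ludersKraus, (proj_posSemidef _).1.eq]

theorem ludersKraus_mul_self {l : ℝ} (hl : l ∈ Set.Icc (0 : ℝ) 1) (y b : Fin 2) :
    ludersKraus l y b * ludersKraus l y b =
      (l : ℂ) • proj (basisKet y b) + ((1 - l : ℝ) : ℂ) • proj (basisKet y (1 - b)) := by
  have h : b ≠ 1 - b := by fin_cases b <;> simp
  simp only [ludersKraus, add_mul, mul_add, smul_mul_assoc, mul_smul_comm, smul_smul,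
    proj_basisKet_mul_proj_basisKet, h, h.symm, if_true, if_false, smul_zero, add_zero, zero_add,
    ← Complex.ofReal_mul, Real.mul_self_sqrt hl.1, Real.mul_self_sqrt (sub_nonneg.2 hl.2)]

theorem isInstrument_ludersKraus {l : ℝ} (hl : l ∈ Set.Icc (0 : ℝ) 1) (y : Fin 2) :
    IsInstrument fun b => krausMap (ludersKraus l y b) := by
  intro X
  simp only [krausMap_apply, (ludersKraus_isHermitian l y _).eq]
  rw [Matrix.trace_add, mul_assoc, mul_assoc, Matrix.trace_mul_comm, mul_assoc,
    Matrix.trace_mul_comm (ludersKraus l y 1), mul_assoc, ← Matrix.trace_add, ← mul_add,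
    ludersKraus_mul_self hl, ludersKraus_mul_self hl]
  have h := (isPOVM_proj_basisKet y).2
  simp only at h
  have e : (l : ℂ) • proj (basisKet y 0) + ((1 - l : ℝ) : ℂ) • proj (basisKet y (1 - 0)) +
      ((l : ℂ) • proj (basisKet y 1) + ((1 - l : ℝ) : ℂ) • proj (basisKet y (1 - 1))) = 1 := by
    rw [← h, sub_zero, sub_self]
    push_cast
    module
  rw [e, mul_one]

/-- The Bloch vectors form a square in the XZ plane, halfway between the axes, with complementary
inputs antipodal. -/
theorem proj_qracKet (x : Fin 2 → Fin 2) :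
    proj (qracKet x) = (1 / 2 : ℝ) • ((1 : Op) +
      bloch ((√2 / 2) • !₂[(-1 : ℝ) ^ (x 1 : ℕ), 0, (-1 : ℝ) ^ (x 0 : ℕ)])) := by
  have hs : ((√2 : ℝ) : ℂ)⁻¹ = (√2 : ℝ) / 2 := by
    rw [← Complex.ofReal_inv, ← Complex.ofReal_ofNat, ← Complex.ofReal_div]
    congr 1
    field_simp
    norm_num
  have h2 : ((√2 : ℝ) : ℂ) ^ 2 = 2 := by
    rw [← Complex.ofReal_pow, Real.sq_sqrt (by norm_num)]; norm_num
  have hr : ((√(2 + √2) : ℝ) : ℂ)⁻¹ * ((√(2 + √2) : ℝ) : ℂ)⁻¹ = 1 - (√2 : ℝ) / 2 := by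
    rw [← mul_inv, ← Complex.ofReal_mul, Real.mul_self_sqrt (by positivity)]
    have : ((2 + √2 : ℝ) : ℂ) ≠ 0 := Complex.ofReal_ne_zero.2 (by positivity)
    rw [eq_comm, ← mul_eq_one_iff_eq_inv₀ this]
    push_cast
    linear_combination (-1 / 2 : ℂ) * h2
  have expand (v : Fin 2 → ℂ) (c : ℝ) : proj ((c : ℂ) • v) = ((c : ℂ) * c) • proj v := by
    ext i j
    simp [proj_apply]
    ring
  rw [qracKet, expand]
  rw [one_div, Complex.ofReal_inv, hr]
  clear expand
  generalize x 0 = a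
  generalize x 1 = b
  fin_cases a <;> fin_cases b <;> ext i j <;> fin_cases i <;> fin_cases j <;>
    simp [proj_apply, qracVec, basisKet, bloch, hs] <;> grind

theorem isState_proj_qracKet (x : Fin 2 → Fin 2) : IsState (proj (qracKet x)) := by
  refine ⟨proj_posSemidef _, ?_⟩
  rw [proj_qracKet]
  simp [bloch, Matrix.trace_fin_two]

/-- Lüders instruments and the quantum random access code. -/
noncomputable def ludersStrategy (l : ℝ) (hl : l ∈ Set.Icc (0 : ℝ) 1) : Strategy where
  state x := proj (qracKet x)
  instr y b := krausMap (ludersKraus l y b)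
  povm z c := proj (basisKet z c)
  isState := isState_proj_qracKet
  isInstrument := isInstrument_ludersKraus hl
  isPOVM := isPOVM_proj_basisKet

theorem ludersKraus_zero_zero (l : ℝ) :
    ludersKraus l 0 0 = !![(√l : ℂ), 0; 0, (√(1 - l) : ℂ)] := by
  ext i j
  fin_cases i <;> fin_cases j <;>
    simp [ludersKraus, proj_basisKet_zero_zero, proj_basisKet_zero_one]

theorem ludersKraus_zero_one (l : ℝ) :
    ludersKraus l 0 1 = !![(√(1 - l) : ℂ), 0; 0, (√l : ℂ)] := by
  ext i j
  fin_cases i <;> fin_cases j <;>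
    simp [ludersKraus, proj_basisKet_zero_zero, proj_basisKet_zero_one]

theorem ludersKraus_one_zero (l : ℝ) :
    ludersKraus l 1 0 = !![((√l : ℂ) + √(1 - l)) / 2, ((√l : ℂ) - √(1 - l)) / 2;
      ((√l : ℂ) - √(1 - l)) / 2, ((√l : ℂ) + √(1 - l)) / 2] := by
  ext i j
  fin_cases i <;> fin_cases j <;>
    simp [ludersKraus, proj_basisKet_one_zero, proj_basisKet_one_one] <;> ring

theorem ludersKraus_one_one (l : ℝ) :
    ludersKraus l 1 1 = !![((√l : ℂ) + √(1 - l)) / 2, ((√(1 - l) : ℂ) - √l) / 2;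
      ((√(1 - l) : ℂ) - √l) / 2, ((√l : ℂ) + √(1 - l)) / 2] := by
  ext i j
  fin_cases i <;> fin_cases j <;>
    simp [ludersKraus, proj_basisKet_one_zero, proj_basisKet_one_one] <;> ring

/-- Bob's correlation is scaled by 2l - 1. Charlie's is untouched if his basis is the one Bob
measured, and is scaled by 2√(l(1 - l)) otherwise. -/
theorem ludersStrategy_avgSuccess (α l : ℝ) (hl : l ∈ Set.Icc (0 : ℝ) 1) :
    avgSuccess α (ludersStrategy l hl).prob =
      1 / 2 + √2 / 16 * (4 * α * (2 * l - 1) + 2 * (1 - α) * (1 + 2 * √(l * (1 - l)))) := by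
  have h1 : √l ^ 2 = l := Real.sq_sqrt hl.1
  have h2 : √(1 - l) ^ 2 = 1 - l := Real.sq_sqrt (sub_nonneg.2 hl.2)
  have e0 : proj (qracKet ![0, 0]) - proj (qracKet ![1, 1]) =
      (√2 / 2 : ℝ) • !![(1 : ℂ), 1; 1, -1] := by
    rw [proj_qracKet, proj_qracKet]
    ext i j
    fin_cases i <;> fin_cases j <;> simp [bloch] <;> ring
  have e1 : proj (qracKet ![0, 1]) - proj (qracKet ![1, 0]) =
      (√2 / 2 : ℝ) • !![(1 : ℂ), -1; -1, -1] := by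
    rw [proj_qracKet, proj_qracKet]
    ext i j
    fin_cases i <;> fin_cases j <;> simp [bloch] <;> ring
  rw [Strategy.avgSuccess_eq, Real.sqrt_mul hl.1]
  simp only [ludersStrategy, e0, e1, map_smul]
  simp only [scoreFunctional, LinearMap.add_apply, LinearMap.smul_apply, smul_eq_mul, bias,
    response, LinearMap.coe_mk, AddHom.coe_mk, krausMap_apply, (ludersKraus_isHermitian l _ _).eq]
  simp only [ludersKraus_zero_zero, ludersKraus_zero_one, ludersKraus_one_zero,
    ludersKraus_one_one, proj_basisKet_zero_zero, proj_basisKet_zero_one, proj_basisKet_one_zero,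
    proj_basisKet_one_one]
  generalize √(1 - l) = m at *
  generalize √l = k at *
  subst h1
  simp [Matrix.trace_fin_two]
  linear_combination (√2 / 8 - 3 / 8 * √2 * α) * h2

theorem one_sub_sq_add_four_mul_sq_pos (α : ℝ) : 0 < (1 - α) ^ 2 + 4 * α ^ 2 := by
  nlinarith [sq_nonneg (5 * α - 1)]

theorem optSharpness_mem_Icc {α : ℝ} (hα : α ∈ Set.Icc (0 : ℝ) 1) :
    optSharpness α ∈ Set.Icc (0 : ℝ) 1 := by
  have hpos := one_sub_sq_add_four_mul_sq_pos α
  have hs : 0 < √((1 - α) ^ 2 + 4 * α ^ 2) := Real.sqrt_pos.2 hpos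
  have h1 : 0 ≤ α / √((1 - α) ^ 2 + 4 * α ^ 2) := div_nonneg hα.1 hs.le
  have h2 : α / √((1 - α) ^ 2 + 4 * α ^ 2) ≤ 1 / 2 := by
    rw [div_le_iff₀ hs]
    have : 2 * α ≤ √((1 - α) ^ 2 + 4 * α ^ 2) := Real.le_sqrt_of_sq_le (by nlinarith)
    linarith
  constructor <;> rw [optSharpness] <;> linarith

theorem ludersStrategy_optSharpness_avgSuccess {α : ℝ} (hα : α ∈ Set.Icc (0 : ℝ) 1) :
    avgSuccess α (ludersStrategy (optSharpness α) (optSharpness_mem_Icc hα)).prob =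
      povmBound α := by
  rw [ludersStrategy_avgSuccess]
  have hpos := one_sub_sq_add_four_mul_sq_pos α
  have hs : 0 < √((1 - α) ^ 2 + 4 * α ^ 2) := Real.sqrt_pos.2 hpos
  have hS : √((1 - α) ^ 2 + 4 * α ^ 2) ^ 2 = (1 - α) ^ 2 + 4 * α ^ 2 := Real.sq_sqrt hpos.le
  rw [povmBound_eq, optSharpness]
  generalize √((1 - α) ^ 2 + 4 * α ^ 2) = s at *
  -- At the optimal sharpness (2l - 1, 2√(l(1 - l))) is the unit vector (2α, 1 - α)/s.
  have hr : √((1 / 2 + α / s) * (1 - (1 / 2 + α / s))) = (1 - α) / (2 * s) := by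
    rw [← Real.sqrt_sq (div_nonneg (sub_nonneg.2 hα.2) (by positivity) : 0 ≤ (1 - α) / (2 * s))]
    congr 1
    field_simp
    linear_combination hS
  rw [hr]
  field_simp
  linear_combination (-32 * √2) * hS

end PTM

theorem proposition2 (α : ℝ) (hα : α ∈ Set.Icc (0 : ℝ) 1) :
    IsGreatest {s : ℝ | ∃ p : PTM.Behaviour, PTM.IsRealizable.{u} p ∧ s = PTM.avgSuccess α p}
      (PTM.povmBound α) ∧
    (α ∈ Set.Ioo (0 : ℝ) 1 → PTM.pvmBound α < PTM.povmBound α) ∧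
    (∃ S : PTM.Strategy,
      (∀ x, S.state x = PTM.proj (PTM.qracKet x)) ∧
      (∀ z c, S.povm z c = PTM.proj (PTM.basisKet z c)) ∧
      (∀ y b X, S.instr y b X =
        PTM.ludersKraus (PTM.optSharpness α) y b * X *
          (PTM.ludersKraus (PTM.optSharpness α) y b).conjTranspose) ∧
      PTM.avgSuccess α S.prob = PTM.povmBound α) := by
  have hS := PTM.ludersStrategy_optSharpness_avgSuccess hα
  refine ⟨⟨⟨_, PTM.Strategy.isRealizable_prob _, hS.symm⟩, ?_⟩, PTM.pvmBound_lt_povmBound,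
    _, fun _ => rfl, fun _ _ => rfl, fun _ _ _ => rfl, hS⟩
  rintro _ ⟨p, hp, rfl⟩
  exact PTM.avgSuccess_le_of_isRealizable hα hp
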